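/- Let $\mathcal H$ be a complex Hilbert space, let $m\ge 1$ be an integer, let $P$ be a bounded operator on $\mathcal H$ that is self-adjoint with $\langle Px;x\rangle\ge 0$ for all $x$ and is invertible with a bounded inverse, and let $A,B$ be bounded operators on $\mathcal H$ that are power bounded ($\sup_n\|A^n\|<\infty$ and $\sup_n\|B^n\|<\infty$) and form an $(m,P)$-biisometric pair, that is, $$\sum_{j=0}^m(-1)^j\binom mj A^{*(m-j)}PB^{m-j}=0 .$$ Write $\langle x;y\rangle_P=\langle Px;y\rangle$. Two operators $S,T$ on $\mathcal H$ are similar if $QS=TQ$ for some invertible bounded operator $Q$ with bounded inverse. (a) Either (i) there is a unitary operator $U$ on $\mathcal H$ such that both $A$ and $B$ are similar to $U$; or (ii) there are nonzero vectors $v\in\ker A^*$ and $w\in\ker B^*$ such that the sequences $\phi_n=A^nP^{-1}w$ and $\psi_n=B^nP^{-1}v$ $(n\ge 0)$ are biorthogonal with respect to $\langle\cdot\,;\cdot\rangle_P$, i.e. $\langle\phi_k;\psi_n\rangle_P=\delta_{k,n}$ for all $k,n\ge 0$; moreover, for all nonzero $v\in\ker A^*$ and $w\in\ker B^*$, the sequences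 $\phi_n=A^nP^{-1}w$ and $\psi_n=B^nP^{-1}v$ satisfy, for every $n\ge 0$, $$A\phi_n=\phi_{n+1},\quad B\psi_n=\psi_{n+1},\quad A^*(P\psi_{n+1})=P\psi_n,\quad B^*(P\phi_{n+1})=P\phi_n .$$ (b) Suppose (i) holds; then $A$ and $B$ are invertible. For an operator $T$ let $\sigma(T)$ be its spectrum, $r(T)=\sup\{|\lambda|:\lambda\in\sigma(T)\}$, $W(T)=\{\langle Tx;x\rangle:\|x\|=1\}$ and $w(T)=\sup\{|\lambda|:\lambda\in W(T)\}$; $T$ is normaloid if $r(T)=\|T\|$, convexoid if $\overline{W(T)}=\operatorname{conv}\sigma(T)$, and spectraloid if $r(T)=w(T)$. If each of $A$ and $A^{-1}$ is normaloid, convexoid or spectraloid (in any combination), then $A$ is unitary and $B=P^{-1}AP$. If each of $B$ and $B^{-1}$ is normaloid, convexoid or spectraloid (in any combination), then $B$ is unitary and $A=P^{-1}BP$. -/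

import Mathlib

open scoped InnerProductSpace

noncomputable section

namespace Biisometric

variable {H : Type*} [NormedAddCommGroup H] [InnerProductSpace ℂ H]

/-- A strictly positive (that is, positive and invertible) operator: self-adjoint,
`⟨P x, x⟩ ≥ 0` for all `x`, and invertible with a bounded inverse. -/
def IsStrictlyPositiveOp [CompleteSpace H] (P : H →L[ℂ] H) : Prop :=
  P.IsPositive ∧ IsUnit P

/-- `A` is power bounded: `sup_n ‖A ^ n‖ < ∞`. -/
def IsPowerBounded (A : H →L[ℂ] H) : Prop :=
  BddAbove (Set.range fun n : ℕ => ‖A ^ n‖)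

/-- `∑_{j=0}^m (-1)^j (m choose j) (A*)^(m-j) P B^(m-j)`. -/
def biisometricDefect [CompleteSpace H] (m : ℕ) (P A B : H →L[ℂ] H) : H →L[ℂ] H :=
  ∑ j ∈ Finset.range (m + 1), ((-1 : ℂ) ^ j * (m.choose j : ℂ)) •
    ((ContinuousLinearMap.adjoint A) ^ (m - j) * P * B ^ (m - j))

/-- `(A, B)` is an `(m, P)`-biisometric pair. -/
def IsBiisometricPair [CompleteSpace H] (m : ℕ) (P A B : H →L[ℂ] H) : Prop :=
  biisometricDefect m P A B = 0

/-- The form `⟨x ; y⟩_P = ⟨P x ; y⟩`, linear in `x` and conjugate-linear in `y`. Mathlib's inner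
product is conjugate-linear in its first argument, hence the order of the arguments. -/
def formP (P : H →L[ℂ] H) (x y : H) : ℂ := ⟪y, P x⟫_ℂ

/-- Two sequences are biorthogonal for `⟨· ; ·⟩_P`: `⟨f m ; g n⟩_P = δ_{m,n}`. -/
def IsBiorthogonal (P : H →L[ℂ] H) (f g : ℕ → H) : Prop :=
  ∀ m n : ℕ, formP P (f m) (g n) = if m = n then 1 else 0

/-- The sequence `n ↦ T ^ n P⁻¹ u` (for invertible `P`). -/
def orbit (T P : H →L[ℂ] H) (u : H) (n : ℕ) : H := (T ^ n) (Ring.inverse P u)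

/-- Shift-like biorthogonal sequences for the pair `(A, B)`. With
`φ_n = A ^ n P⁻¹ w` and `ψ_n = B ^ n P⁻¹ v`, there are nonzero `v ∈ ker A*` and `w ∈ ker B*` for
which `{φ_n}` and `{ψ_n}` are biorthogonal for `⟨· ; ·⟩_P`; moreover, for all nonzero
`v ∈ ker A*` and `w ∈ ker B*` and all `n`, one has `A φ_n = φ_{n+1}`, `B ψ_n = ψ_{n+1}`,
`A* (P ψ_{n+1}) = P ψ_n` and `B* (P φ_{n+1}) = P φ_n`. -/
def HasShiftLikeBiorthogonalSequences [CompleteSpace H] (P A B : H →L[ℂ] H) : Prop :=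
  (∃ v w : H, v ≠ 0 ∧ w ≠ 0 ∧
      ContinuousLinearMap.adjoint A v = 0 ∧ ContinuousLinearMap.adjoint B w = 0 ∧
      IsBiorthogonal P (orbit A P w) (orbit B P v)) ∧
  ∀ v w : H, v ≠ 0 → w ≠ 0 →
    ContinuousLinearMap.adjoint A v = 0 → ContinuousLinearMap.adjoint B w = 0 →
    ∀ n : ℕ,
      A (orbit A P w n) = orbit A P w (n + 1) ∧
      B (orbit B P v n) = orbit B P v (n + 1) ∧
      ContinuousLinearMap.adjoint A (P (orbit B P v (n + 1))) = P (orbit B P v n) ∧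
      ContinuousLinearMap.adjoint B (P (orbit A P w (n + 1))) = P (orbit A P w n)

/-- There is one unitary operator `U` on `H` to which both `A` and `B` are similar
(`IsConj A U` means `Q A = U Q` for some invertible operator `Q`). -/
def SimilarToSameUnitary [CompleteSpace H] (A B : H →L[ℂ] H) : Prop :=
  ∃ U : H →L[ℂ] H, U ∈ unitary (H →L[ℂ] H) ∧ IsConj A U ∧ IsConj B U

/-- The numerical range `W(A) = {⟨A x ; x⟩ : ‖x‖ = 1}`. -/
def numericalRange (A : H →L[ℂ] H) : Set ℂ :=
  {z | ∃ x : H, ‖x‖ = 1 ∧ ⟪x, A x⟫_ℂ = z}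

/-- The numerical radius `w(A) = sup {|z| : z ∈ W(A)}`, with values in `[0, ∞]`, as for Mathlib's
`spectralRadius`. -/
def numericalRadius (A : H →L[ℂ] H) : ENNReal :=
  ⨆ z ∈ numericalRange A, ‖z‖ₑ

/-- `r(A) = ‖A‖`. -/
def IsNormaloid (A : H →L[ℂ] H) : Prop := spectralRadius ℂ A = ‖A‖ₑ

/-- The closure of `W(A)` is the convex hull of the spectrum of `A`. -/
def IsConvexoid (A : H →L[ℂ] H) : Prop :=
  closure (numericalRange A) = convexHull ℝ (spectrum ℂ A)

/-- `r(A) = w(A)`. -/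
def IsSpectraloid (A : H →L[ℂ] H) : Prop := spectralRadius ℂ A = numericalRadius A

/-- `A` is normaloid or convexoid or spectraloid. -/
def IsNormaloidConvexoidOrSpectraloid (A : H →L[ℂ] H) : Prop :=
  IsNormaloid A ∨ IsConvexoid A ∨ IsSpectraloid A

end Biisometric

end

/-!
The defect of the pair is `(L - 1) ^ m` applied to `P`, where `L X = A* X B`. Since `A` and `B` are
power bounded, the orbit `L ^ n P = A* ^ n P B ^ n` is bounded; a bounded orbit cannot grow
polynomially, so `L P = P`, that is, `A* P B = P`, and by taking adjoints `B* P A = P`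
(`adjoint_mul_mul_eq_of_isBiisometricPair`).

If `A*` is injective, `A` is invertible with `A⁻¹ = P⁻¹ B* P`, so all integer powers of `A` are
uniformly bounded and `A` is similar to a unitary operator `U` by Sz.-Nagy's theorem
(`exists_unitary_isConj`), proved here with an ultrafilter limit of Cesàro means in the role of
an invariant mean. As `B = P⁻¹ (A*)⁻¹ P`, also `B` is similar to `U`. If `A* v = 0` with `v ≠ 0`,
then `P⁻¹ v` does not lie in the (closed) range of `B`, on which `A* P` is injective. So `P⁻¹ v` is
not orthogonal to `ker B*`, and this provides `w` with `⟨w, P⁻¹ v⟩ = 1`. Biorthogonality follows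
from the shift relations (`isBiorthogonal_orbit`).

For the second part, if `A` is similar to a unitary operator, then the spectra of `A` and `A⁻¹` lie
in the unit circle, and each of the three conditions gives numerical radius at most `1`. It remains
to see that an operator `T`, with `T` and `T⁻¹` power bounded and of numerical radius at most `1`,
is isometric (`norm_map_eq_of_numericalRadius_le_one`). The condition `w(T) ≤ 1` means that the
tridiagonal Toeplitz operator with `2` on the diagonal and `-T`, `-T*` next to it is nonnegative.
Its Schur complement `q` yields a function `p x = 2 ‖x‖ ^ 2 - q x`, between `0` and `2 ‖x‖ ^ 2`,
which decreases along the orbits of `T`, strictly from `x` to `T x` unless `p (T x)` equals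
`‖T x‖ ^ 2` (`exists_isLyapunov`). As a bounded monotone sequence converges, `p` is asymptotic
to the squared norm along every orbit. The same construction for `T⁻¹` gives a function that
increases along the orbits of `T` with the same asymptotics at both ends. Hence the two functions
coincide, are constant along orbits, and equal the squared norm.
-/

namespace Biisometric

open ContinuousLinearMap Filter Topology

/-! ### Bounded orbits and the reduction to `A* P B = P` -/

/-- If the orbit of `x` under `L` is bounded and `x` is a generalized eigenvector for the
eigenvalue `1`, then it is an eigenvector: otherwise `‖L ^ n x‖` would grow at least linearly. -/
theorem sub_one_apply_eq_zero_of_bounded_orbit {E : Type*} [NormedAddCommGroup E]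
    [NormedSpace ℂ E] (L : Module.End ℂ E) (k : ℕ) :
    ∀ (x : E) (C : ℝ), (∀ n, ‖(L ^ n) x‖ ≤ C) → ((L - 1) ^ (k + 1)) x = 0 → (L - 1) x = 0 := by
  induction k with
  | zero => intro x C _ hx; simpa using hx
  | succ k ih =>
    intro x C hC hx
    have hy : (L - 1) ((L - 1) x) = 0 := by
      refine ih ((L - 1) x) (C + C) (fun n => ?_) ?_
      · have : (L ^ n) ((L - 1) x) = (L ^ (n + 1)) x - (L ^ n) x := by
          simp [pow_succ, Module.End.mul_apply]
        rw [this]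
        exact (norm_sub_le _ _).trans (add_le_add (hC _) (hC _))
      · rw [pow_succ, Module.End.mul_apply] at hx
        exact hx
    set y := (L - 1) x with hydef
    have hLy : L y = y := by
      simpa [sub_eq_zero] using hy
    have hLx : L x = x + y := by
      simp [hydef]
    have hn : ∀ n : ℕ, (L ^ n) x = x + (n : ℂ) • y := by
      intro n
      induction n with
      | zero => simp
      | succ n ihn =>
        rw [pow_succ', Module.End.mul_apply, ihn, map_add, map_smul, hLy, hLx]
        push_cast
        module
    by_contra hne
    have hpos : 0 < ‖y‖ := norm_pos_iff.mpr hne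
    obtain ⟨n, hnlt⟩ := exists_nat_gt ((C + ‖x‖) / ‖y‖)
    rw [div_lt_iff₀ hpos] at hnlt
    have h1 : ‖(n : ℂ) • y‖ ≤ C + ‖x‖ := by
      have h2 : (n : ℂ) • y = (L ^ n) x - x := by rw [hn]; abel
      rw [h2]
      exact (norm_sub_le _ _).trans (add_le_add_left (hC n) _)
    rw [norm_smul, Complex.norm_natCast] at h1
    linarith

variable {H : Type*} [NormedAddCommGroup H] [InnerProductSpace ℂ H]

theorem mulLeft_mul_mulRight_pow_apply (S T X : H →L[ℂ] H) (n : ℕ) :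
    ((LinearMap.mulLeft ℂ S * LinearMap.mulRight ℂ T) ^ n) X = S ^ n * X * T ^ n := by
  induction n with
  | zero => simp
  | succ n ih =>
    rw [pow_succ', Module.End.mul_apply, ih, Module.End.mul_apply, LinearMap.mulRight_apply,
      LinearMap.mulLeft_apply, pow_succ', pow_succ T]
    simp only [mul_assoc]

theorem IsPowerBounded.exists_bound {A : H →L[ℂ] H} (hA : IsPowerBounded A) :
    ∃ C : ℝ, ∀ n, ‖A ^ n‖ ≤ C := by
  obtain ⟨C, hC⟩ := hA
  exact ⟨C, fun n => hC ⟨n, rfl⟩⟩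

theorem map_orbit (T P : H →L[ℂ] H) (u : H) (n : ℕ) :
    T (orbit T P u n) = orbit T P u (n + 1) := by
  simp [orbit, pow_succ']

variable [CompleteSpace H]

/-- The defect is the `m`-th power of `X ↦ A* X B - X` evaluated at `P`. -/
theorem biisometricDefect_eq (m : ℕ) (P A B : H →L[ℂ] H) :
    biisometricDefect m P A B =
      ((LinearMap.mulLeft ℂ (adjoint A) * LinearMap.mulRight ℂ B - 1) ^ m) P := by
  set L : Module.End ℂ (H →L[ℂ] H) :=
    LinearMap.mulLeft ℂ (adjoint A) * LinearMap.mulRight ℂ B with hL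
  have hc : Commute (-1 : Module.End ℂ (H →L[ℂ] H)) L := (Commute.one_left L).neg_left
  rw [sub_eq_neg_add, hc.add_pow, LinearMap.sum_apply]
  refine Finset.sum_congr rfl fun j _ => ?_
  rw [← mulLeft_mul_mulRight_pow_apply, ← hL]
  have h1 : (-1 : Module.End ℂ (H →L[ℂ] H)) ^ j * L ^ (m - j) * (m.choose j : Module.End ℂ _) =
      ((-1 : ℂ) ^ j * (m.choose j : ℂ)) • L ^ (m - j) := by
    rw [← (Nat.cast_commute (m.choose j) _).eq, mul_smul]
    rcases Nat.even_or_odd j with hj | hj <;>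
      simp [hj.neg_one_pow (α := ℂ), hj.neg_one_pow (α := Module.End ℂ (H →L[ℂ] H)),
        Nat.cast_smul_eq_nsmul, nsmul_eq_mul]
  rw [h1, LinearMap.smul_apply]

theorem norm_adjoint_pow (A : H →L[ℂ] H) (n : ℕ) : ‖adjoint A ^ n‖ = ‖A ^ n‖ := by
  rw [← star_eq_adjoint, ← star_pow, norm_star]

/-- For power bounded operators, an `(m, P)`-biisometric pair is a `(1, P)`-biisometric pair. -/
theorem adjoint_mul_mul_eq_of_isBiisometricPair {m : ℕ} (hm : 1 ≤ m) {P A B : H →L[ℂ] H}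
    (hA : IsPowerBounded A) (hB : IsPowerBounded B) (hAB : IsBiisometricPair m P A B) :
    adjoint A * P * B = P := by
  obtain ⟨k, rfl⟩ : ∃ k, m = k + 1 := ⟨m - 1, by omega⟩
  obtain ⟨C, hC⟩ := hA.exists_bound
  obtain ⟨D, hD⟩ := hB.exists_bound
  rw [IsBiisometricPair, biisometricDefect_eq] at hAB
  have h := sub_one_apply_eq_zero_of_bounded_orbit _ k P (C * ‖P‖ * D) (fun n => ?_) hAB
  · simpa [sub_eq_zero, mul_assoc] using h
  · have hC0 : 0 ≤ C := (norm_nonneg _).trans (hC 0)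
    rw [mulLeft_mul_mulRight_pow_apply]
    calc ‖adjoint A ^ n * P * B ^ n‖ ≤ ‖adjoint A ^ n‖ * ‖P‖ * ‖B ^ n‖ :=
          (norm_mul_le _ _).trans (mul_le_mul_of_nonneg_right (norm_mul_le _ _) (norm_nonneg _))
      _ ≤ C * ‖P‖ * D := by
          rw [norm_adjoint_pow]
          exact mul_le_mul (mul_le_mul_of_nonneg_right (hC n) (norm_nonneg _)) (hD n)
            (norm_nonneg _) (mul_nonneg hC0 (norm_nonneg _))

theorem IsStrictlyPositiveOp.adjoint_eq {P : H →L[ℂ] H} (hP : IsStrictlyPositiveOp P) :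
    adjoint P = P := hP.1.isSelfAdjoint.adjoint_eq

/-- Taking adjoints exchanges the roles of `A` and `B`. -/
theorem adjoint_mul_mul_eq_swap {P A B : H →L[ℂ] H} (hP : IsStrictlyPositiveOp P)
    (h : adjoint A * P * B = P) : adjoint B * P * A = P := by
  have h' := congrArg star h
  rwa [star_mul, star_mul, star_eq_adjoint, star_eq_adjoint, star_eq_adjoint, adjoint_adjoint,
    hP.adjoint_eq, ← mul_assoc] at h'

/-! ### Biorthogonal sequences -/

theorem adjoint_apply_map_orbit_succ {P A B : H →L[ℂ] H} (h : adjoint A * P * B = P)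
    (v : H) (n : ℕ) :
    adjoint A (P (orbit B P v (n + 1))) = P (orbit B P v n) := by
  have := DFunLike.congr_fun h (orbit B P v n)
  simpa [orbit, pow_succ'] using this

theorem IsStrictlyPositiveOp.apply_inverse_apply {P : H →L[ℂ] H} (hP : IsStrictlyPositiveOp P)
    (u : H) : P (Ring.inverse P u) = u :=
  DFunLike.congr_fun (Ring.mul_inverse_cancel P hP.2) u

theorem map_orbit_zero {P : H →L[ℂ] H} (hP : IsStrictlyPositiveOp P) (T : H →L[ℂ] H) (u : H) :
    P (orbit T P u 0) = u :=
  hP.apply_inverse_apply u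

theorem formP_orbit_succ_succ {P A B : H →L[ℂ] H} (hP : IsStrictlyPositiveOp P)
    (h : adjoint A * P * B = P) (v w : H) (k n : ℕ) :
    formP P (orbit A P w (k + 1)) (orbit B P v (n + 1)) =
      formP P (orbit A P w k) (orbit B P v n) := by
  unfold formP
  rw [← map_orbit B P v n, ← adjoint_inner_right,
    adjoint_apply_map_orbit_succ (adjoint_mul_mul_eq_swap hP h)]

theorem isBiorthogonal_orbit {P A B : H →L[ℂ] H} (hP : IsStrictlyPositiveOp P)
    (h : adjoint A * P * B = P) {v w : H} (hv : adjoint A v = 0) (hw : adjoint B w = 0)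
    (hvw : ⟪Ring.inverse P v, w⟫_ℂ = 1) :
    IsBiorthogonal P (orbit A P w) (orbit B P v) := by
  intro k
  induction k with
  | zero =>
    rintro (_ | n)
    · simpa [formP, orbit, hP.apply_inverse_apply] using hvw
    · simp [formP, map_orbit_zero hP, ← map_orbit B P v n, ← adjoint_inner_right, hw]
  | succ k ih =>
    rintro (_ | n)
    · have hPs : ∀ x y : H, ⟪x, P y⟫_ℂ = ⟪P x, y⟫_ℂ := fun x y => by
        rw [← adjoint_inner_left, hP.adjoint_eq]
      simp [formP, ← map_orbit A P w k, hPs, map_orbit_zero hP, ← adjoint_inner_left, hv]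
    · rw [formP_orbit_succ_succ hP h v w, ih n]
      simp

/-- The range of `B` is closed, since `B` has the left inverse `P⁻¹ A* P`. -/
theorem isClosed_range_of_adjoint_mul_mul_eq {P A B : H →L[ℂ] H} (hP : IsStrictlyPositiveOp P)
    (h : adjoint A * P * B = P) : IsClosed (Set.range B) := by
  have hl : ∀ x, (Ring.inverse P * adjoint A * P) (B x) = x := fun x => by
    have := DFunLike.congr_fun
      (show Ring.inverse P * adjoint A * P * B = 1 by
        rw [mul_assoc, mul_assoc, ← mul_assoc _ P B, h, Ring.inverse_mul_cancel P hP.2]) x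
    simpa using this
  have : Set.range B = {y | B ((Ring.inverse P * adjoint A * P) y) = y} := by
    ext y
    constructor
    · rintro ⟨x, rfl⟩
      simp only [Set.mem_ofPred_eq, hl]
    · intro hy
      exact ⟨_, hy⟩
  rw [this]
  exact isClosed_eq (by fun_prop) continuous_id

/-- If `P⁻¹ v` were orthogonal to `ker B*`, it would lie in the range of `B`; but `A* P` is
injective there and kills `P⁻¹ v`. -/
theorem exists_inner_eq_one {P A B : H →L[ℂ] H} (hP : IsStrictlyPositiveOp P)
    (h : adjoint A * P * B = P) {v : H} (hv0 : v ≠ 0) (hv : adjoint A v = 0) :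
    ∃ w, adjoint B w = 0 ∧ ⟪Ring.inverse P v, w⟫_ℂ = 1 := by
  have key : ∃ w, adjoint B w = 0 ∧ ⟪Ring.inverse P v, w⟫_ℂ ≠ 0 := by
    by_contra! hcon
    have hcl : IsClosed ((LinearMap.range (B : H →ₗ[ℂ] H) : Submodule ℂ H) : Set H) := by
      rw [LinearMap.coe_range]
      exact isClosed_range_of_adjoint_mul_mul_eq hP h
    have hmem : Ring.inverse P v ∈ (LinearMap.range (B : H →ₗ[ℂ] H))ᗮᗮ := by
      rw [orthogonal_range, Submodule.mem_orthogonal']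
      exact fun w hw => hcon w hw
    rw [Submodule.orthogonal_orthogonal_eq_closure, hcl.submodule_topologicalClosure_eq] at hmem
    obtain ⟨u, hu⟩ := hmem
    have hu : B u = Ring.inverse P v := hu
    have hPv : P (Ring.inverse P v) = v := hP.apply_inverse_apply v
    have hPu : P u = 0 := by
      have := DFunLike.congr_fun h u
      simp only [mul_apply_eq_comp, hu, hPv, hv] at this
      exact this.symm
    have hu0 : u = 0 := by
      have := DFunLike.congr_fun (Ring.inverse_mul_cancel P hP.2) u
      simpa [hPu] using this.symm
    rw [hu0, map_zero] at hu
    rw [← hu, map_zero] at hPv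
    exact hv0 hPv.symm
  obtain ⟨w, hw, hne⟩ := key
  exact ⟨(⟪Ring.inverse P v, w⟫_ℂ)⁻¹ • w, by simp [hw], by
    rw [inner_smul_right, inv_mul_cancel₀ hne]⟩

theorem hasShiftLikeBiorthogonalSequences {P A B : H →L[ℂ] H} (hP : IsStrictlyPositiveOp P)
    (h : adjoint A * P * B = P) {v : H} (hv0 : v ≠ 0) (hv : adjoint A v = 0) :
    HasShiftLikeBiorthogonalSequences P A B := by
  obtain ⟨w, hw, hvw⟩ := exists_inner_eq_one hP h hv0 hv
  refine ⟨⟨v, w, hv0, ?_, hv, hw, isBiorthogonal_orbit hP h hv hw hvw⟩, ?_⟩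
  · rintro rfl
    simp at hvw
  · intro v w _ _ _ _ n
    exact ⟨map_orbit A P w n, map_orbit B P v n, adjoint_apply_map_orbit_succ h v n,
      adjoint_apply_map_orbit_succ (adjoint_mul_mul_eq_swap hP h) w n⟩

end Biisometric

namespace Biisometric

open ContinuousLinearMap Filter Topology

/-! ### Contractive numerical radius and a Lyapunov function -/

/-- Parseval's identity for the discrete Fourier transform of vector-valued sequences. -/
theorem sum_inner_dft {H : Type*} [NormedAddCommGroup H] [InnerProductSpace ℂ H] {M : ℕ} {ζ : ℂ}
    (hM : M ≠ 0) (hζ : IsPrimitiveRoot ζ M) (f g : ℕ → H) :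
    ∑ j ∈ Finset.range M, ⟪∑ k ∈ Finset.range M, ζ ^ (j * k) • f k,
      ∑ l ∈ Finset.range M, ζ ^ (j * l) • g l⟫_ℂ =
    M * ∑ k ∈ Finset.range M, ⟪f k, g k⟫_ℂ := by
  have hn : ‖ζ‖ = 1 := hζ.norm'_eq_one hM
  have hζ0 : ζ ≠ 0 := hζ.ne_zero hM
  have hconj : (starRingEnd ℂ) ζ = ζ⁻¹ := (Complex.inv_eq_conj hn).symm
  have horth : ∀ k ∈ Finset.range M, ∀ l ∈ Finset.range M,
      ∑ j ∈ Finset.range M, (starRingEnd ℂ) (ζ ^ (j * k)) * ζ ^ (j * l) =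
        if k = l then (M : ℂ) else 0 := by
    intro k hk l hl
    rw [Finset.mem_range] at hk hl
    have hterm : ∀ j, (starRingEnd ℂ) (ζ ^ (j * k)) * ζ ^ (j * l) = (ζ ^ l / ζ ^ k) ^ j := by
      intro j
      rw [map_pow, hconj, inv_pow, div_pow, ← pow_mul, ← pow_mul, mul_comm j k, mul_comm j l,
        div_eq_inv_mul]
    simp_rw [hterm]
    split_ifs with hkl
    · subst hkl
      simp [div_self (pow_ne_zero k hζ0)]
    · have hne : ζ ^ l / ζ ^ k ≠ 1 := by
        rw [Ne, div_eq_one_iff_eq (pow_ne_zero k hζ0)]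
        exact fun h => hkl (hζ.pow_inj hl hk h).symm
      have hone : (ζ ^ l / ζ ^ k) ^ M = 1 := by
        rw [div_pow, ← pow_mul, ← pow_mul, mul_comm l, mul_comm k, pow_mul, pow_mul, hζ.pow_eq_one]
        simp
      rw [geom_sum_eq hne, hone, sub_self, zero_div]
  calc _ = ∑ j ∈ Finset.range M, ∑ k ∈ Finset.range M, ∑ l ∈ Finset.range M,
        ((starRingEnd ℂ) (ζ ^ (j * k)) * ζ ^ (j * l)) * ⟪f k, g l⟫_ℂ := by
        refine Finset.sum_congr rfl fun j _ => ?_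
        rw [sum_inner]
        refine Finset.sum_congr rfl fun k _ => ?_
        rw [inner_sum]
        refine Finset.sum_congr rfl fun l _ => ?_
        rw [inner_smul_left, inner_smul_right, mul_assoc]
    _ = ∑ k ∈ Finset.range M, ∑ l ∈ Finset.range M, (if k = l then (M : ℂ) else 0) *
        ⟪f k, g l⟫_ℂ := by
        rw [Finset.sum_comm]
        refine Finset.sum_congr rfl fun k hk => ?_
        rw [Finset.sum_comm]
        refine Finset.sum_congr rfl fun l hl => ?_
        rw [← Finset.sum_mul, horth k hk l hl]
    _ = _ := by
        rw [Finset.mul_sum]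
        refine Finset.sum_congr rfl fun k hk => ?_
        simp only [ite_mul, zero_mul, Finset.sum_ite_eq, hk, if_true]

variable {H : Type*} [NormedAddCommGroup H] [InnerProductSpace ℂ H]

/-- The quadratic form of the tridiagonal Toeplitz operator with `2` on the diagonal and `-T`,
`-T*` next to it, on a sequence cut off at `N`. -/
noncomputable def toeplitzEnergy (T : H →L[ℂ] H) (N : ℕ) (f : ℕ → H) : ℝ :=
  ∑ k ∈ Finset.range N, (2 * ‖f k‖ ^ 2 - 2 * (⟪f (k + 1), T (f k)⟫_ℂ).re)

/-- If `w(T) ≤ 1`, the Toeplitz form is nonnegative: it is an average over roots of unity `z` of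
`2 Re ⟨(1 - z T) X, X⟩`, where `X = ∑ z ^ k f k`. -/
theorem toeplitzEnergy_nonneg {T : H →L[ℂ] H} (hT : ∀ x, ‖⟪x, T x⟫_ℂ‖ ≤ ‖x‖ ^ 2) {N : ℕ}
    {f : ℕ → H} (hf : f N = 0) : 0 ≤ toeplitzEnergy T N f := by
  have hM : N + 1 ≠ 0 := N.succ_ne_zero
  set ζ : ℂ := Complex.exp (2 * Real.pi * Complex.I / (N + 1 : ℕ)) with hζdef
  have hζ : IsPrimitiveRoot ζ (N + 1) := Complex.isPrimitiveRoot_exp (N + 1) hM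
  have hn : ‖ζ‖ = 1 := hζ.norm'_eq_one hM
  -- the sequence `T f`, shifted by one place, has transform `ζ ^ j T X j`
  let g : ℕ → H := fun k => Nat.casesOn k 0 fun l => T (f l)
  have hg0 : g 0 = 0 := rfl
  have hg1 : ∀ l, g (l + 1) = T (f l) := fun _ => rfl
  let X : ℕ → H := fun j => ∑ k ∈ Finset.range (N + 1), ζ ^ (j * k) • f k
  have hg : ∀ j, ∑ l ∈ Finset.range (N + 1), ζ ^ (j * l) • g l = ζ ^ j • T (X j) := by
    intro j
    simp only [X]
    rw [Finset.sum_range_succ', Finset.sum_range_succ, hf]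
    simp only [hg0, hg1, smul_zero, add_zero, map_sum, map_smul, Finset.smul_sum, smul_smul]
    refine Finset.sum_congr rfl fun k _ => ?_
    rw [← pow_add]
    congr 2
    ring
  have h1 := sum_inner_dft hM hζ f f
  have h2 := sum_inner_dft hM hζ f g
  simp_rw [hg] at h2
  have hpt : ∀ j, 0 ≤ (⟪X j, X j⟫_ℂ - ⟪X j, ζ ^ j • T (X j)⟫_ℂ).re := by
    intro j
    have h3 : (⟪X j, X j⟫_ℂ).re = ‖X j‖ ^ 2 := by
      rw [inner_self_eq_norm_sq_to_K]
      norm_cast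
    have h4 : (⟪X j, ζ ^ j • T (X j)⟫_ℂ).re ≤ ‖X j‖ ^ 2 := by
      refine (Complex.re_le_norm _).trans ?_
      rw [inner_smul_right, norm_mul, norm_pow, hn, one_pow, one_mul]
      exact hT _
    rw [Complex.sub_re, h3]
    linarith
  have hsum : 0 ≤ (∑ j ∈ Finset.range (N + 1),
      (⟪X j, X j⟫_ℂ - ⟪X j, ζ ^ j • T (X j)⟫_ℂ)).re := by
    rw [Complex.re_sum]
    exact Finset.sum_nonneg fun j _ => hpt j
  rw [Finset.sum_sub_distrib] at hsum
  simp only [X] at hsum h2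
  rw [h1, h2, ← mul_sub, ← Finset.sum_sub_distrib] at hsum
  have hE : toeplitzEnergy T N f =
      2 * (∑ k ∈ Finset.range (N + 1), (⟪f k, f k⟫_ℂ - ⟪f k, g k⟫_ℂ)).re := by
    rw [Finset.sum_sub_distrib, Finset.sum_range_succ,
      Finset.sum_range_succ' (fun k => ⟪f k, g k⟫_ℂ), hf, toeplitzEnergy,
      Finset.sum_sub_distrib, ← Finset.mul_sum, ← Finset.mul_sum]
    simp only [hg0, hg1, inner_zero_right, add_zero, Complex.sub_re, Complex.re_sum]
    have : ∀ k, (⟪f k, f k⟫_ℂ).re = ‖f k‖ ^ 2 := fun k => by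
      rw [inner_self_eq_norm_sq_to_K]
      norm_cast
    simp_rw [this]
    ring
  have hpos : (0 : ℝ) < ((N + 1 : ℕ) : ℝ) := by positivity
  rw [← Complex.ofReal_natCast, Complex.re_ofReal_mul] at hsum
  rw [hE]
  exact mul_nonneg zero_le_two (nonneg_of_mul_nonneg_right hsum hpos)

/-- The energies of all finite sequences starting at `x`. -/
def energySet (T : H →L[ℂ] H) (x : H) : Set ℝ :=
  {r | ∃ (N : ℕ) (f : ℕ → H), f 0 = x ∧ f N = 0 ∧ toeplitzEnergy T N f = r}

theorem cons_mem_energySet {T : H →L[ℂ] H} (x : H) {y : H} {r : ℝ} (hr : r ∈ energySet T y) :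
    2 * ‖x‖ ^ 2 - 2 * (⟪y, T x⟫_ℂ).re + r ∈ energySet T x := by
  obtain ⟨N, f, rfl, hN, rfl⟩ := hr
  refine ⟨N + 1, fun k => Nat.casesOn k x f, rfl, hN, ?_⟩
  rw [toeplitzEnergy, Finset.sum_range_succ', add_comm]
  rfl

theorem smul_mem_energySet {T : H →L[ℂ] H} (s : ℝ) {y : H} {r : ℝ} (hr : r ∈ energySet T y) :
    s ^ 2 * r ∈ energySet T ((s : ℂ) • y) := by
  obtain ⟨N, f, rfl, hN, rfl⟩ := hr
  refine ⟨N, fun k => (s : ℂ) • f k, rfl, by simp [hN], ?_⟩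
  rw [toeplitzEnergy, toeplitzEnergy, Finset.mul_sum]
  refine Finset.sum_congr rfl fun k _ => ?_
  rw [map_smul, inner_smul_left, inner_smul_right, norm_smul, Complex.conj_ofReal,
    Complex.re_ofReal_mul, Complex.re_ofReal_mul, Complex.norm_real, mul_pow, Real.norm_eq_abs,
    sq_abs]
  ring

theorem two_mul_norm_sq_mem_energySet (T : H →L[ℂ] H) (x : H) :
    2 * ‖x‖ ^ 2 ∈ energySet T x := by
  have h := cons_mem_energySet (T := T) x (y := 0) (r := 0) ⟨0, fun _ => 0, rfl, rfl, rfl⟩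
  simpa using h

/-- A function comparable to the squared norm which decreases along the orbits of `T`, the
decrease controlling its distance from the squared norm. -/
structure IsLyapunov (T : H →L[ℂ] H) (p : H → ℝ) : Prop where
  nonneg : ∀ x, 0 ≤ p x
  le : ∀ x, p x ≤ 2 * ‖x‖ ^ 2
  map_le : ∀ x, p (T x) ≤ p x
  sq_le : ∀ x, (p (T x) - ‖T x‖ ^ 2) ^ 2 ≤ 2 * ‖T x‖ ^ 2 * (p x - p (T x))

/-- An operator with `w(T) ≤ 1` has a Lyapunov function, namely `2 ‖x‖ ^ 2` minus the Schur
complement `q x` of the Toeplitz form, that is, the infimum of the energies of the sequences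
starting at `x`. Prepending `x` to the sequences starting at `s T x`, for all real `s`, gives
`‖T x‖ ^ 4 ≤ p x * q (T x)`. -/
theorem exists_isLyapunov {T : H →L[ℂ] H} (hT : ∀ x, ‖⟪x, T x⟫_ℂ‖ ≤ ‖x‖ ^ 2) :
    ∃ p, IsLyapunov T p := by
  let q : H → ℝ := fun x => sInf (energySet T x)
  have hlb : ∀ x, ∀ r ∈ energySet T x, 0 ≤ r := by
    rintro x r ⟨N, f, -, hN, rfl⟩
    exact toeplitzEnergy_nonneg hT hN
  have hbdd : ∀ x, BddBelow (energySet T x) := fun x => ⟨0, fun r hr => hlb x r hr⟩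
  have hne : ∀ x, (energySet T x).Nonempty := fun x => ⟨_, two_mul_norm_sq_mem_energySet T x⟩
  have hq0 : ∀ x, 0 ≤ q x := fun x => le_csInf (hne x) (hlb x)
  have hq2 : ∀ x, q x ≤ 2 * ‖x‖ ^ 2 := fun x =>
    csInf_le (hbdd x) (two_mul_norm_sq_mem_energySet T x)
  have hquad : ∀ x (s : ℝ), 0 ≤ q (T x) * (s * s) + (-2 * ‖T x‖ ^ 2) * s +
      (2 * ‖x‖ ^ 2 - q x) := by
    intro x s
    have hr : ∀ r ∈ energySet T (T x), q x ≤ 2 * ‖x‖ ^ 2 - 2 * (s * ‖T x‖ ^ 2) + s ^ 2 * r := by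
      intro r hr
      have h := csInf_le (hbdd x) (cons_mem_energySet x (smul_mem_energySet s hr))
      rw [inner_smul_left, Complex.conj_ofReal, Complex.re_ofReal_mul,
        inner_self_eq_norm_sq_to_K] at h
      norm_cast at h
    rcases eq_or_ne s 0 with rfl | hs
    · have := hq2 x
      simp only [mul_zero, zero_add]
      linarith
    · have hs2 : 0 < s ^ 2 := by positivity
      have h := le_csInf (hne (T x)) (a := (q x - 2 * ‖x‖ ^ 2 + 2 * (s * ‖T x‖ ^ 2)) / s ^ 2)
        fun r hr' => by
          rw [div_le_iff₀ hs2]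
          linarith [hr r hr']
      rw [div_le_iff₀ hs2] at h
      change _ ≤ q (T x) * s ^ 2 at h
      linarith
  refine ⟨fun x => 2 * ‖x‖ ^ 2 - q x, fun x => by linarith [hq2 x], fun x => by linarith [hq0 x],
    fun x => by linarith [hquad x 1], fun x => ?_⟩
  have hd := discrim_le_zero (hquad x)
  have h1 := hquad x 1
  have h2 := hq2 (T x)
  rw [discrim] at hd
  nlinarith [mul_nonneg (show 0 ≤ 2 * ‖T x‖ ^ 2 - q (T x) by linarith)
    (show 0 ≤ (2 * ‖x‖ ^ 2 - q x) - (2 * ‖T x‖ ^ 2 - q (T x)) by linarith)]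

/-! ### Operators with `w(T) ≤ 1` and `w(T⁻¹) ≤ 1` -/

theorem tendsto_zero_of_sq_le {a b : ℕ → ℝ} {c : ℝ} (h : ∀ n, a n ^ 2 ≤ c * b n)
    (hb : Tendsto b atTop (𝓝 0)) : Tendsto a atTop (𝓝 0) := by
  have h1 : Tendsto (fun n => a n ^ 2) atTop (𝓝 0) :=
    squeeze_zero (fun n => sq_nonneg _) h (by simpa using hb.const_mul c)
  have h2 := h1.sqrt
  simp only [Real.sqrt_sq_eq_abs, Real.sqrt_zero] at h2
  exact (tendsto_zero_iff_abs_tendsto_zero _).mpr h2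

/-- Along `T ^ n x` both functions approach the squared norm, while `p₁ - p₂` decreases. -/
theorem IsLyapunov.le_of_leftInverse {T S : H →L[ℂ] H} {p₁ p₂ : H → ℝ} (h₁ : IsLyapunov T p₁)
    (h₂ : IsLyapunov S p₂) (hST : ∀ x, S (T x) = x) {C : ℝ} (hC : ∀ n, ‖T ^ n‖ ≤ C) (x : H) :
    p₂ x ≤ p₁ x := by
  set y : ℕ → H := fun n => (T ^ n) x with hy
  have hyT : ∀ n, y (n + 1) = T (y n) := fun n => by simp only [hy, pow_succ']; rfl
  have hyS : ∀ n, S (y (n + 1)) = y n := fun n => by rw [hyT, hST]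
  have hyC : ∀ n, ‖y n‖ ^ 2 ≤ (C * ‖x‖) ^ 2 := fun n =>
    pow_le_pow_left₀ (norm_nonneg _) (((T ^ n).le_opNorm x).trans
      (mul_le_mul_of_nonneg_right (hC n) (norm_nonneg _))) 2
  have hanti : Antitone fun n => p₁ (y n) := antitone_nat_of_succ_le fun n => by
    rw [hyT]; exact h₁.map_le _
  have hmono : Monotone fun n => p₂ (y n) := monotone_nat_of_le_succ fun n => by
    have := h₂.map_le (y (n + 1))
    rwa [hyS] at this
  have hl₁ := tendsto_atTop_ciInf hanti ⟨0, by rintro _ ⟨n, rfl⟩; exact h₁.nonneg _⟩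
  have hl₂ := tendsto_atTop_ciSup hmono ⟨2 * (C * ‖x‖) ^ 2, by
    rintro _ ⟨n, rfl⟩; exact (h₂.le _).trans (by linarith [hyC n])⟩
  have hd₁ : Tendsto (fun n => p₁ (y n) - p₁ (y (n + 1))) atTop (𝓝 0) := by
    simpa using hl₁.sub ((tendsto_add_atTop_iff_nat 1).mpr hl₁)
  have hd₂ : Tendsto (fun n => p₂ (y (n + 1)) - p₂ (y n)) atTop (𝓝 0) := by
    simpa using ((tendsto_add_atTop_iff_nat 1).mpr hl₂).sub hl₂
  have he₁ : Tendsto (fun n => p₁ (y (n + 1)) - ‖y (n + 1)‖ ^ 2) atTop (𝓝 0) := by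
    refine tendsto_zero_of_sq_le (c := 2 * (C * ‖x‖) ^ 2) (fun n => ?_) hd₁
    have := h₁.sq_le (y n)
    rw [← hyT] at this
    exact this.trans (mul_le_mul_of_nonneg_right (by linarith [hyC (n + 1)])
      (sub_nonneg.mpr (hanti n.le_succ)))
  have he₂ : Tendsto (fun n => p₂ (y n) - ‖y n‖ ^ 2) atTop (𝓝 0) := by
    refine tendsto_zero_of_sq_le (c := 2 * (C * ‖x‖) ^ 2) (fun n => ?_) hd₂
    have := h₂.sq_le (y (n + 1))
    rw [hyS] at this
    exact this.trans (mul_le_mul_of_nonneg_right (by linarith [hyC n])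
      (sub_nonneg.mpr (hmono n.le_succ)))
  have hlim : Tendsto (fun n => p₁ (y n) - p₂ (y n)) atTop (𝓝 0) := by
    simpa using ((tendsto_add_atTop_iff_nat (f := fun n => p₁ (y n) - ‖y n‖ ^ 2) 1).mp he₁).sub he₂
  have hda : Antitone fun n => p₁ (y n) - p₂ (y n) := fun a b hab =>
    sub_le_sub (hanti hab) (hmono hab)
  have h0 := hda.le_of_tendsto hlim 0
  simpa [hy] using h0

/-- If `T` and `T⁻¹` are power bounded with numerical radius at most `1`, then `T` is an isometry:
the Lyapunov functions of `T` and `T⁻¹` agree, hence are constant along orbits, hence equal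
to the squared norm. -/
theorem norm_map_eq_of_numericalRadius_le_one {T S : H →L[ℂ] H} (hST : S * T = 1) (hTS : T * S = 1)
    {C : ℝ} (hTC : ∀ n, ‖T ^ n‖ ≤ C) (hSC : ∀ n, ‖S ^ n‖ ≤ C)
    (hT : ∀ x, ‖⟪x, T x⟫_ℂ‖ ≤ ‖x‖ ^ 2) (hS : ∀ x, ‖⟪x, S x⟫_ℂ‖ ≤ ‖x‖ ^ 2) (x : H) :
    ‖T x‖ = ‖x‖ := by
  have hST' : ∀ x, S (T x) = x := fun x => by simpa using DFunLike.congr_fun hST x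
  have hTS' : ∀ x, T (S x) = x := fun x => by simpa using DFunLike.congr_fun hTS x
  obtain ⟨p₁, h₁⟩ := exists_isLyapunov hT
  obtain ⟨p₂, h₂⟩ := exists_isLyapunov hS
  have heq : ∀ x, p₁ x = p₂ x := fun x =>
    le_antisymm (h₂.le_of_leftInverse h₁ hTS' hSC x) (h₁.le_of_leftInverse h₂ hST' hTC x)
  have hinv : ∀ x, p₁ (T x) = p₁ x := fun x => by
    refine le_antisymm (h₁.map_le x) ?_
    have := h₂.map_le (T x)
    rwa [hST', ← heq, ← heq] at this
  have hsq : ∀ x, p₁ (T x) = ‖T x‖ ^ 2 := fun x => by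
    have := h₁.sq_le x
    rw [hinv, sub_self, mul_zero] at this
    rw [hinv]
    exact sub_eq_zero.mp (pow_eq_zero_iff two_ne_zero |>.mp (le_antisymm this (sq_nonneg _)))
  have hx : p₁ x = ‖x‖ ^ 2 := by
    have := hsq (S x)
    rwa [hTS'] at this
  have h := hsq x
  rw [hinv, hx] at h
  exact ((pow_left_inj₀ (norm_nonneg _) (norm_nonneg _) two_ne_zero).mp h).symm

/-! ### Normaloid, convexoid and spectraloid operators -/

/-- If the spectrum lies in the unit circle, each of the three conditions gives `w(A) ≤ 1`. -/
theorem norm_inner_le_of_spectrum_subset {A : H →L[ℂ] H}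
    (hs : spectrum ℂ A ⊆ Metric.sphere 0 1) (hA : IsNormaloidConvexoidOrSpectraloid A) (x : H) :
    ‖⟪x, A x⟫_ℂ‖ ≤ ‖x‖ ^ 2 := by
  have hr : spectralRadius ℂ A ≤ 1 := iSup₂_le fun k hk => by
    have : ‖k‖₊ = 1 := NNReal.eq (by simpa using hs hk)
    simp [this]
  have hunit : ∀ y : H, ‖y‖ = 1 → ‖⟪y, A y⟫_ℂ‖ ≤ 1 := by
    intro y hy
    rcases hA with h | h | h
    · have hn : ‖A‖ ≤ 1 := by
        rw [IsNormaloid] at h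
        rw [h, ← ofReal_norm, ENNReal.ofReal_le_one] at hr
        exact hr
      calc ‖⟪y, A y⟫_ℂ‖ ≤ ‖y‖ * ‖A y‖ := norm_inner_le_norm _ _
        _ ≤ ‖y‖ * (‖A‖ * ‖y‖) := by gcongr; exact A.le_opNorm y
        _ ≤ 1 := by rw [hy]; simpa using hn
    · have hmem : ⟪y, A y⟫_ℂ ∈ convexHull ℝ (spectrum ℂ A) :=
        (show closure (numericalRange A) = _ from h) ▸ subset_closure ⟨y, hy, rfl⟩
      have hball : convexHull ℝ (spectrum ℂ A) ⊆ Metric.closedBall 0 1 :=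
        convexHull_min (hs.trans Metric.sphere_subset_closedBall) (convex_closedBall 0 1)
      simpa using hball hmem
    · have hle : ‖⟪y, A y⟫_ℂ‖ₑ ≤ numericalRadius A :=
        le_iSup₂ (f := fun (z : ℂ) (_ : z ∈ numericalRange A) => ‖z‖ₑ) _ ⟨y, hy, rfl⟩
      rw [IsSpectraloid] at h
      have := hle.trans (h ▸ hr)
      rwa [← ofReal_norm, ENNReal.ofReal_le_one] at this
  rcases eq_or_ne x 0 with rfl | hx
  · simp
  · have hx0 : ‖x‖ ≠ 0 := norm_ne_zero_iff.mpr hx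
    have h := hunit (((‖x‖⁻¹ : ℝ) : ℂ) • x) (by
      rw [norm_smul, Complex.norm_real, norm_inv, norm_norm, inv_mul_cancel₀ hx0])
    rw [map_smul, inner_smul_left, inner_smul_right, norm_mul, norm_mul, Complex.conj_ofReal,
      Complex.norm_real, norm_inv, norm_norm, ← mul_assoc, ← mul_inv,
      inv_mul_le_iff₀ (by positivity), mul_one, ← sq] at h
    exact h

end Biisometric

namespace Biisometric

open ContinuousLinearMap Filter Topology

variable {H : Type*} [NormedAddCommGroup H] [InnerProductSpace ℂ H]

/-! ### Similarity to a unitary operator -/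

/-- The Cesàro means of `⟨A ^ k x, A ^ k y⟩`. -/
noncomputable def cesaroInner (A : H →L[ℂ] H) (n : ℕ) (x y : H) : ℂ :=
  ((n + 1 : ℕ) : ℂ)⁻¹ * ∑ k ∈ Finset.range (n + 1), ⟪(A ^ k) x, (A ^ k) y⟫_ℂ

theorem norm_cesaroInner_le {A : H →L[ℂ] H} {C : ℝ} (hC : ∀ n, ‖A ^ n‖ ≤ C) (n : ℕ) (x y : H) :
    ‖cesaroInner A n x y‖ ≤ C ^ 2 * ‖x‖ * ‖y‖ := by
  have hC0 : 0 ≤ C := (norm_nonneg _).trans (hC 0)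
  have hle : ∀ k z, ‖(A ^ k) z‖ ≤ C * ‖z‖ := fun k z =>
    ((A ^ k).le_opNorm z).trans (mul_le_mul_of_nonneg_right (hC k) (norm_nonneg _))
  have hpos : (0 : ℝ) < ((n + 1 : ℕ) : ℝ) := by positivity
  rw [cesaroInner, norm_mul, norm_inv, Complex.norm_natCast, inv_mul_le_iff₀ hpos]
  refine (norm_sum_le _ _).trans ?_
  calc ∑ k ∈ Finset.range (n + 1), ‖⟪(A ^ k) x, (A ^ k) y⟫_ℂ‖
      ≤ ∑ _k ∈ Finset.range (n + 1), C ^ 2 * ‖x‖ * ‖y‖ := by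
        refine Finset.sum_le_sum fun k _ => (norm_inner_le_norm _ _).trans ?_
        calc ‖(A ^ k) x‖ * ‖(A ^ k) y‖ ≤ (C * ‖x‖) * (C * ‖y‖) :=
              mul_le_mul (hle k x) (hle k y) (norm_nonneg _) (by positivity)
          _ = C ^ 2 * ‖x‖ * ‖y‖ := by ring
    _ = _ := by simp

theorem cesaroInner_map_sub (A : H →L[ℂ] H) (n : ℕ) (x y : H) :
    cesaroInner A n (A x) (A y) - cesaroInner A n x y =
      ((n + 1 : ℕ) : ℂ)⁻¹ * (⟪(A ^ (n + 1)) x, (A ^ (n + 1)) y⟫_ℂ - ⟪x, y⟫_ℂ) := by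
  have h : ∀ k z, (A ^ k) (A z) = (A ^ (k + 1)) z := fun k z => by rw [pow_succ]; rfl
  simp_rw [cesaroInner, h]
  rw [← mul_sub, ← Finset.sum_sub_distrib,
    Finset.sum_range_sub (fun k => ⟪(A ^ k) x, (A ^ k) y⟫_ℂ)]
  simp

theorem le_re_cesaroInner {A : H →L[ℂ] H} {c : ℝ} (hc : ∀ n x, c * ‖x‖ ^ 2 ≤ ‖(A ^ n) x‖ ^ 2)
    (n : ℕ) (x : H) : c * ‖x‖ ^ 2 ≤ (cesaroInner A n x x).re := by
  have hpos : (0 : ℝ) < ((n + 1 : ℕ) : ℝ) := by positivity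
  rw [cesaroInner, ← Complex.ofReal_natCast, ← Complex.ofReal_inv, Complex.re_ofReal_mul,
    le_inv_mul_iff₀ hpos, Complex.re_sum]
  calc _ = ∑ _k ∈ Finset.range (n + 1), c * ‖x‖ ^ 2 := by simp
    _ ≤ _ := by
      refine Finset.sum_le_sum fun k _ => (hc k x).trans_eq ?_
      rw [inner_self_eq_norm_sq_to_K]
      norm_cast

variable [CompleteSpace H]

/-- A power bounded operator with power bounded inverse is an isometry for an equivalent inner
product `⟨Q x, y⟩`, obtained as an ultrafilter limit of Cesàro means. -/
theorem exists_adjoint_mul_mul_eq_self {A : H →L[ℂ] H} {C c : ℝ} (hC : ∀ n, ‖A ^ n‖ ≤ C)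
    (hc0 : 0 < c) (hc : ∀ n x, c * ‖x‖ ^ 2 ≤ ‖(A ^ n) x‖ ^ 2) :
    ∃ Q : H →L[ℂ] H, Q.IsPositive ∧ IsUnit Q ∧ adjoint A * Q * A = Q := by
  have hex : ∀ x y, ∃ b ∈ Metric.closedBall (0 : ℂ) (C ^ 2 * ‖x‖ * ‖y‖),
      Tendsto (fun n => cesaroInner A n x y) (hyperfilter ℕ) (𝓝 b) := fun x y =>
    (isCompact_closedBall (0 : ℂ) (C ^ 2 * ‖x‖ * ‖y‖)).ultrafilter_le_nhds'
      ((hyperfilter ℕ).map fun n => cesaroInner A n x y)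
      (Ultrafilter.mem_map.mpr (Filter.univ_mem' fun n => by
        simpa using norm_cesaroInner_le hC n x y))
  choose b hbC hb using hex
  have hadd₁ : ∀ x x' y, b (x + x') y = b x y + b x' y := fun x x' y =>
    tendsto_nhds_unique (hb _ _) (((hb x y).add (hb x' y)).congr fun n => by
      simp [cesaroInner, Finset.sum_add_distrib, mul_add])
  have hadd₂ : ∀ x y y', b x (y + y') = b x y + b x y' := fun x y y' =>
    tendsto_nhds_unique (hb _ _) (((hb x y).add (hb x y')).congr fun n => by
      simp [cesaroInner, Finset.sum_add_distrib, mul_add])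
  have hsmul₁ : ∀ (a : ℂ) x y, b (a • x) y = (starRingEnd ℂ) a • b x y := fun a x y =>
    tendsto_nhds_unique (hb _ _) (((hb x y).const_smul _).congr fun n => by
      simp only [cesaroInner, map_smul, inner_smul_left, ← Finset.mul_sum, smul_eq_mul]
      ring)
  have hsmul₂ : ∀ (a : ℂ) x y, b x (a • y) = a • b x y := fun a x y =>
    tendsto_nhds_unique (hb _ _) (((hb x y).const_smul _).congr fun n => by
      simp only [cesaroInner, map_smul, inner_smul_right, ← Finset.mul_sum, smul_eq_mul]
      ring)
  have hsymm : ∀ x y, (starRingEnd ℂ) (b y x) = b x y := fun x y =>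
    tendsto_nhds_unique (((Complex.continuous_conj.tendsto _).comp (hb y x)))
      ((hb x y).congr fun n => by simp [cesaroInner])
  have hlow : ∀ x, c * ‖x‖ ^ 2 ≤ (b x x).re := fun x =>
    ge_of_tendsto ((Complex.continuous_re.tendsto _).comp (hb x x))
      (Eventually.of_forall fun n => le_re_cesaroInner hc n x)
  have hinv : ∀ x y, b (A x) (A y) = b x y := fun x y => by
    refine sub_eq_zero.mp (tendsto_nhds_unique ((hb (A x) (A y)).sub (hb x y)) ?_)
    refine Tendsto.mono_left ?_ Nat.hyperfilter_le_atTop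
    have hz : Tendsto (fun n : ℕ => ((n + 1 : ℕ) : ℝ)⁻¹ *
        (C * ‖x‖ * (C * ‖y‖) + ‖x‖ * ‖y‖)) atTop (𝓝 0) := by
      simpa using ((tendsto_inv_atTop_zero.comp (tendsto_natCast_atTop_atTop (R := ℝ))).comp
        (tendsto_add_atTop_nat 1)).mul_const (C * ‖x‖ * (C * ‖y‖) + ‖x‖ * ‖y‖)
    refine squeeze_zero_norm (fun n => ?_) hz
    rw [cesaroInner_map_sub, norm_mul, norm_inv, Complex.norm_natCast]
    refine mul_le_mul_of_nonneg_left ((norm_sub_le _ _).trans (add_le_add ?_ ?_)) (by positivity)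
    · have hle : ∀ z, ‖(A ^ (n + 1)) z‖ ≤ C * ‖z‖ := fun z =>
        ((A ^ (n + 1)).le_opNorm z).trans
          (mul_le_mul_of_nonneg_right (hC _) (norm_nonneg _))
      exact (norm_inner_le_norm _ _).trans
        (mul_le_mul (hle x) (hle y) (norm_nonneg _) ((norm_nonneg _).trans (hle x)))
    · exact norm_inner_le_norm _ _
  let F : H →L⋆[ℂ] H →L[ℂ] ℂ :=
    (LinearMap.mk₂'ₛₗ (starRingEnd ℂ) (RingHom.id ℂ) b hadd₁ hsmul₁ hadd₂ hsmul₂).mkContinuous₂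
      (C ^ 2) fun x y => by simpa using hbC x y
  let Q : H →L[ℂ] H := InnerProductSpace.continuousLinearMapOfBilin F
  have hQ : ∀ x y, ⟪Q x, y⟫_ℂ = b x y := fun x y =>
    InnerProductSpace.continuousLinearMapOfBilin_apply F x y
  refine ⟨Q, ?_, ?_, ?_⟩
  · rw [isPositive_iff]
    refine ⟨fun x y => ?_, fun x => ?_⟩
    · change ⟪Q x, y⟫_ℂ = ⟪x, Q y⟫_ℂ
      rw [hQ, ← inner_conj_symm, hQ, hsymm]
    · rw [hQ, Complex.nonneg_iff]
      exact ⟨le_trans (by positivity) (hlow x), (Complex.conj_eq_iff_im.mp (hsymm x x)).symm⟩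
  · refine isUnit_of_forall_le_norm_inner_map Q (c := NNReal.mk c hc0.le) hc0 fun x => ?_
    rw [hQ, NNReal.coe_mk, mul_comm]
    exact (hlow x).trans (Complex.re_le_norm _)
  · ext x
    refine ext_inner_right ℂ fun y => ?_
    change ⟪adjoint A (Q (A x)), y⟫_ℂ = _
    rw [adjoint_inner_left, hQ, hQ, hinv]

theorem mem_unitary_of_isUnit {R : Type*} [Monoid R] [StarMul R] {U : R} (hU : IsUnit U)
    (h : star U * U = 1) : U ∈ unitary R :=
  Unitary.mem_iff.mpr ⟨h, hU.mul_right_cancel (by rw [mul_assoc, h, mul_one, one_mul])⟩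

/-- **Sz.-Nagy's theorem**: an invertible operator whose positive and negative powers are uniformly
bounded is similar to a unitary operator. -/
theorem exists_unitary_isConj {A S : H →L[ℂ] H} (hSA : S * A = 1) (hAS : A * S = 1)
    (hA : IsPowerBounded A) (hS : IsPowerBounded S) :
    ∃ U ∈ unitary (H →L[ℂ] H), IsConj A U := by
  obtain ⟨C, hC⟩ := hA.exists_bound
  obtain ⟨D, hD⟩ := hS.exists_bound
  have hD0 : 0 ≤ D := (norm_nonneg _).trans (hD 0)
  -- `D + 1` rather than `D`, since `D` may vanish when `H` is trivial
  have hc : ∀ n x, ((D + 1) ^ 2)⁻¹ * ‖x‖ ^ 2 ≤ ‖(A ^ n) x‖ ^ 2 := by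
    intro n x
    have hn : S ^ n * A ^ n = 1 := by
      have hcomm : Commute S A := hSA.trans hAS.symm
      rw [← hcomm.mul_pow, hSA, one_pow]
    rw [inv_mul_le_iff₀ (by positivity), ← mul_pow]
    refine pow_le_pow_left₀ (norm_nonneg _) ?_ 2
    calc ‖x‖ = ‖(S ^ n) ((A ^ n) x)‖ := by
          congr 1
          exact (DFunLike.congr_fun hn x).symm
      _ ≤ D * ‖(A ^ n) x‖ := ((S ^ n).le_opNorm _).trans
          (mul_le_mul_of_nonneg_right (hD n) (norm_nonneg _))
      _ ≤ (D + 1) * ‖(A ^ n) x‖ :=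
          mul_le_mul_of_nonneg_right (by linarith) (norm_nonneg _)
  obtain ⟨Q, hQpos, hQu, hQ⟩ := exists_adjoint_mul_mul_eq_self hC (by positivity) hc
  have hQ0 : 0 ≤ Q := (nonneg_iff_isPositive Q).mpr hQpos
  obtain ⟨R, hR⟩ : IsUnit (CFC.sqrt Q) := (CFC.isUnit_sqrt_iff Q hQ0).mpr hQu
  have hRR : (R : H →L[ℂ] H) * R = Q := by rw [hR]; exact CFC.sqrt_mul_sqrt_self Q hQ0
  have hRs : star (R : H →L[ℂ] H) = R := by
    rw [hR]
    exact (IsSelfAdjoint.of_nonneg (CFC.sqrt_nonneg Q)).star_eq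
  have hRis : star ((R⁻¹ : (H →L[ℂ] H)ˣ) : H →L[ℂ] H) = ((R⁻¹ : (H →L[ℂ] H)ˣ) : H →L[ℂ] H) := by
    rw [← Units.coe_star, star_inv]
    congr 2
    exact Units.ext hRs
  refine ⟨R * A * ((R⁻¹ : (H →L[ℂ] H)ˣ) : H →L[ℂ] H), ?_, R, ?_⟩
  · have hleft : star (R * A * ((R⁻¹ : (H →L[ℂ] H)ˣ) : H →L[ℂ] H)) *
        (R * A * ((R⁻¹ : (H →L[ℂ] H)ˣ) : H →L[ℂ] H)) = 1 := by
      rw [star_mul, star_mul, hRis, hRs, star_eq_adjoint]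
      calc _ = ((R⁻¹ : (H →L[ℂ] H)ˣ) : H →L[ℂ] H) * (adjoint A * ((R : H →L[ℂ] H) * R) * A) *
            ((R⁻¹ : (H →L[ℂ] H)ˣ) : H →L[ℂ] H) := by simp only [mul_assoc]
        _ = 1 := by
          rw [hRR, hQ, ← hRR, Units.inv_mul_cancel_left, Units.mul_inv]
    have hAu : IsUnit A := ⟨⟨A, S, hAS, hSA⟩, rfl⟩
    have hu : IsUnit (R * A * ((R⁻¹ : (H →L[ℂ] H)ˣ) : H →L[ℂ] H)) :=
      (R.isUnit.mul hAu).mul R⁻¹.isUnit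
    exact mem_unitary_of_isUnit hu hleft
  · rw [SemiconjBy, mul_assoc, Units.inv_mul, mul_one]

/-- If `A*` is injective, then `A` is invertible, `A⁻¹ = P⁻¹ B* P` is power bounded, and `B` is
similar to `(A*)⁻¹`, hence to the same unitary operator as `A`. -/
theorem similarToSameUnitary_of_injective_adjoint {P A B : H →L[ℂ] H}
    (hP : IsStrictlyPositiveOp P) (hA : IsPowerBounded A) (hB : IsPowerBounded B)
    (h : adjoint A * P * B = P) (hker : ∀ v, adjoint A v = 0 → v = 0) :
    SimilarToSameUnitary A B := by
  have h' := adjoint_mul_mul_eq_swap hP h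
  obtain ⟨p, rfl⟩ := hP.2
  have hAu : IsUnit A := by
    have hsurj : Function.Surjective (adjoint A) := fun y =>
      ⟨((p : H →L[ℂ] H) * B * ((p⁻¹ : (H →L[ℂ] H)ˣ) : H →L[ℂ] H)) y, by
        have : adjoint A * ((p : H →L[ℂ] H) * B * ((p⁻¹ : (H →L[ℂ] H)ˣ) : H →L[ℂ] H)) = 1 := by
          rw [← mul_assoc, ← mul_assoc, h, Units.mul_inv]
        exact DFunLike.congr_fun this y⟩
    have hu : IsUnit (star A) := isUnit_iff_bijective.mpr
      ⟨(injective_iff_map_eq_zero (adjoint A)).mpr hker, hsurj⟩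
    simpa using hu.star
  set S : H →L[ℂ] H := ((p⁻¹ : (H →L[ℂ] H)ˣ) : H →L[ℂ] H) * adjoint B * p with hS
  have hSA : S * A = 1 := by
    rw [hS, mul_assoc, mul_assoc, ← mul_assoc _ _ A, h', Units.inv_mul]
  have hAS : A * S = 1 := hAu.mul_right_cancel (by rw [mul_assoc, hSA, mul_one, one_mul])
  have hSb : IsPowerBounded S := by
    obtain ⟨D, hD⟩ := hB.exists_bound
    refine ⟨‖((p⁻¹ : (H →L[ℂ] H)ˣ) : H →L[ℂ] H)‖ * D * ‖(p : H →L[ℂ] H)‖, ?_⟩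
    rintro _ ⟨n, rfl⟩
    simp only [hS, Units.conj_pow']
    refine (norm_mul_le _ _).trans (mul_le_mul_of_nonneg_right ((norm_mul_le _ _).trans
      (mul_le_mul_of_nonneg_left ?_ (norm_nonneg _))) (norm_nonneg _))
    rw [norm_adjoint_pow]
    exact hD n
  obtain ⟨U, hU, u, hu⟩ := exists_unitary_isConj hSA hAS hA hSb
  refine ⟨U, hU, ⟨u, hu⟩, (star u)⁻¹ * p, ?_⟩
  -- taking adjoints in `u A = U u` gives `U u*⁻¹ A* = u*⁻¹`
  have h1 : star A * star u = star (u : H →L[ℂ] H) * star U := by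
    have := congrArg star hu.eq
    simpa [star_mul] using this
  have h2 : U * (((star u)⁻¹ : (H →L[ℂ] H)ˣ) : H →L[ℂ] H) * star A =
      (((star u)⁻¹ : (H →L[ℂ] H)ˣ) : H →L[ℂ] H) := by
    rw [← Units.mul_left_inj (star u), Units.inv_mul, mul_assoc, h1, mul_assoc, ← Units.coe_star,
      Units.inv_mul_cancel_left]
    exact (Unitary.mem_iff.mp hU).2
  rw [SemiconjBy, Units.val_mul]
  calc (((star u)⁻¹ : (H →L[ℂ] H)ˣ) : H →L[ℂ] H) * p * B
      = U * (((star u)⁻¹ : (H →L[ℂ] H)ˣ) : H →L[ℂ] H) * (star A * p * B) := by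
        rw [← mul_assoc, ← mul_assoc, h2]
    _ = _ := by rw [star_eq_adjoint, h, mul_assoc]

/-! ### Operators similar to a unitary operator -/

theorem spectrum_subset_sphere_of_isConj {A U : H →L[ℂ] H} (hU : U ∈ unitary (H →L[ℂ] H))
    (h : IsConj A U) : spectrum ℂ A ⊆ Metric.sphere 0 1 := by
  obtain ⟨u, hu⟩ := h
  have hA : (u : H →L[ℂ] H) * A * ((u⁻¹ : (H →L[ℂ] H)ˣ) : H →L[ℂ] H) = U := by
    rw [hu.eq, Units.mul_inv_cancel_right]
  rw [← spectrum.units_conjugate (u := u), hA]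
  exact spectrum.subset_circle_of_unitary hU

theorem isPowerBounded_of_isConj {A U : H →L[ℂ] H} (hU : U ∈ unitary (H →L[ℂ] H))
    (h : IsConj A U) : IsPowerBounded A := by
  obtain ⟨u, hu⟩ := h
  refine ⟨‖((u⁻¹ : (H →L[ℂ] H)ˣ) : H →L[ℂ] H)‖ * 1 * ‖(u : H →L[ℂ] H)‖, ?_⟩
  rintro _ ⟨n, rfl⟩
  have hn : A ^ n = ((u⁻¹ : (H →L[ℂ] H)ˣ) : H →L[ℂ] H) * U ^ n * u := by
    rw [mul_assoc, ← (hu.pow_right n).eq, Units.inv_mul_cancel_left]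
  have hU1 : ‖U ^ n‖ ≤ 1 := by
    refine ContinuousLinearMap.opNorm_le_bound _ zero_le_one fun x => ?_
    have h1 : adjoint (U ^ n) ∘L (U ^ n) = 1 :=
      (Unitary.mem_iff.mp (pow_mem hU n)).1
    rw [(norm_map_iff_adjoint_comp_self (U ^ n)).mpr h1, one_mul]
  simp only [hn]
  exact (norm_mul_le _ _).trans (mul_le_mul_of_nonneg_right ((norm_mul_le _ _).trans
    (mul_le_mul_of_nonneg_left hU1 (norm_nonneg _))) (norm_nonneg _))

/-- If `A` is similar to a unitary operator, and `A` and `A⁻¹` both satisfy one of the three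
conditions, then `A` is unitary. -/
theorem mem_unitary_of_isConj {A U : H →L[ℂ] H} (hU : U ∈ unitary (H →L[ℂ] H))
    (h : IsConj A U) (hA : IsNormaloidConvexoidOrSpectraloid A)
    (hA' : IsNormaloidConvexoidOrSpectraloid (Ring.inverse A)) : A ∈ unitary (H →L[ℂ] H) := by
  have hAu : IsUnit A := by
    obtain ⟨u, hu⟩ := h
    have : A = ((u⁻¹ : (H →L[ℂ] H)ˣ) : H →L[ℂ] H) * U * u := by
      rw [mul_assoc, ← hu.eq, Units.inv_mul_cancel_left]
    rw [this]
    exact (u⁻¹.isUnit.mul ⟨Unitary.toUnits ⟨U, hU⟩, rfl⟩).mul u.isUnit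
  have h' : IsConj (Ring.inverse A) (star U) := by
    obtain ⟨u, hu⟩ := h
    refine ⟨u, ?_⟩
    have h1 := hu.eq
    have h2 : star U * U = 1 := (Unitary.mem_iff.mp hU).1
    calc (u : H →L[ℂ] H) * Ring.inverse A = star U * (U * u) * Ring.inverse A := by
          rw [← mul_assoc, h2, one_mul]
      _ = star U * u := by
          rw [← h1, mul_assoc, mul_assoc, Ring.mul_inverse_cancel A hAu, mul_one]
  have hU' : star U ∈ unitary (H →L[ℂ] H) := Unitary.star_mem hU
  obtain ⟨C, hC⟩ := (isPowerBounded_of_isConj hU h).exists_bound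
  obtain ⟨D, hD⟩ := (isPowerBounded_of_isConj hU' h').exists_bound
  refine mem_unitary_of_isUnit hAu ((norm_map_iff_adjoint_comp_self A).mp ?_)
  exact norm_map_eq_of_numericalRadius_le_one (Ring.inverse_mul_cancel A hAu)
    (Ring.mul_inverse_cancel A hAu) (fun n => (hC n).trans (le_max_left C D))
    (fun n => (hD n).trans (le_max_right C D))
    (norm_inner_le_of_spectrum_subset (spectrum_subset_sphere_of_isConj hU h) hA)
    (norm_inner_le_of_spectrum_subset (spectrum_subset_sphere_of_isConj hU' h') hA')

theorem eq_inverse_mul_mul_of_mem_unitary {P A B : H →L[ℂ] H} (hP : IsStrictlyPositiveOp P)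
    (h : adjoint A * P * B = P) (hA : A ∈ unitary (H →L[ℂ] H)) :
    B = Ring.inverse P * A * P := by
  have h1 : A * adjoint A = 1 := (Unitary.mem_iff.mp hA).2
  calc B = Ring.inverse P * ((A * adjoint A) * P * B) := by
        rw [h1, one_mul, ← mul_assoc, Ring.inverse_mul_cancel P hP.2, one_mul]
    _ = Ring.inverse P * (A * (adjoint A * P * B)) := by simp only [mul_assoc]
    _ = _ := by rw [h, mul_assoc]

end Biisometric

theorem theorem6p1 {H : Type*} [NormedAddCommGroup H] [InnerProductSpace ℂ H] [CompleteSpace H]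
    (m : ℕ) (hm : 1 ≤ m) (P A B : H →L[ℂ] H)
    (hP : Biisometric.IsStrictlyPositiveOp P)
    (hA : Biisometric.IsPowerBounded A) (hB : Biisometric.IsPowerBounded B)
    (hAB : Biisometric.IsBiisometricPair m P A B) :
    (Biisometric.SimilarToSameUnitary A B ∨
      Biisometric.HasShiftLikeBiorthogonalSequences P A B) ∧
    (Biisometric.SimilarToSameUnitary A B →
      (Biisometric.IsNormaloidConvexoidOrSpectraloid A →
        Biisometric.IsNormaloidConvexoidOrSpectraloid (Ring.inverse A) →
        A ∈ unitary (H →L[ℂ] H) ∧ B = Ring.inverse P * A * P) ∧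
      (Biisometric.IsNormaloidConvexoidOrSpectraloid B →
        Biisometric.IsNormaloidConvexoidOrSpectraloid (Ring.inverse B) →
        B ∈ unitary (H →L[ℂ] H) ∧ A = Ring.inverse P * B * P)) := by
  have h := Biisometric.adjoint_mul_mul_eq_of_isBiisometricPair hm hA hB hAB
  have h' := Biisometric.adjoint_mul_mul_eq_swap hP h
  refine ⟨?_, ?_⟩
  · by_cases hker : ∀ v, ContinuousLinearMap.adjoint A v = 0 → v = 0
    · exact Or.inl (Biisometric.similarToSameUnitary_of_injective_adjoint hP hA hB h hker)
    · push Not at hker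
      obtain ⟨v, hv, hv0⟩ := hker
      exact Or.inr (Biisometric.hasShiftLikeBiorthogonalSequences hP h hv0 hv)
  · rintro ⟨U, hU, hAU, hBU⟩
    refine ⟨fun hA₁ hA₂ => ?_, fun hB₁ hB₂ => ?_⟩
    · have hAu := Biisometric.mem_unitary_of_isConj hU hAU hA₁ hA₂
      exact ⟨hAu, Biisometric.eq_inverse_mul_mul_of_mem_unitary hP h hAu⟩
    · have hBu := Biisometric.mem_unitary_of_isConj hU hBU hB₁ hB₂
      exact ⟨hBu, Biisometric.eq_inverse_mul_mul_of_mem_unitary hP h' hBu⟩
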